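/- **Graphs.** A weighted graph $G=(V,m,E,a)$ consists of an at most countable vertex set $V$, masses $m:V\to(0,\infty)$, a locally finite edge set $E\subseteq V\times V$, and weights $a:V\times V\to[0,\infty)$ with $a(v,w)>0$ iff $(v,w)\in E$. It is undirected if $a(v,w)=a(w,v)$ for all $v,w$, and it has bounded degrees if there is $C>0$ with $\sum_w a(v,w)\le C\,m(v)$ and $\sum_w a(w,v)\le C\,m(v)$ for all $v$. On the Hilbert space $\ell^2(G)$ of functions $f:V\to\mathbb C$ with $\sum_v|f(v)|^2m(v)<\infty$ and inner product $\langle f,g\rangle=\sum_v\overline{f(v)}g(v)m(v)$, the Laplacian of a graph with bounded degrees is the bounded operator $$(Lf)(x)=\frac1{m(x)}\Big(\sum_{y}a(x,y)\,f(x)-\sum_{y}a(x,y)f(y)\Big).$$ **Setting.** Let $G=(V,m,E,a)$ be an undirected weighted graph with bounded degrees. Let $\{\hat E_i\}_{i\in I}$ be a countable family of symmetric edge sets $\hat E_i\subseteq E$, with sets $\hat V_i$ of incident vertices, such that $\sum_{v\in\hat V_i}m(v)<\infty$ for every $i$, the sets $\hat V_i$ are pairwise disjoint, and any two vertices of $\hat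 V_i$ are joined by a path of edges in $\hat E_i$. Put $\hat E=\bigcup_i\hat E_i$. For $\beta\in[0,\infty)$ let $G_\beta=(V,m,E,a_\beta)$ be undirected weighted graphs, each with bounded degrees (with a bound that may depend on $\beta$), such that $G_0=G$; for $\tilde\beta>\beta$ one has $a_{\tilde\beta}=a$ on $E\setminus\hat E$ and $a_{\tilde\beta}>a_\beta$ on $\hat E$; and $a_\beta(v,w)\to\infty$ as $\beta\to\infty$ for each $(v,w)\in\hat E$. Let $L_\beta$ be the Laplacian of $G_\beta$ on $\ell^2(G_\beta)=\ell^2(G)$. **Reduced graph.** Let $\underline V$ be the set of connected components of $(V,\hat E)$ (a vertex on no edge of $\hat E$ is a component by itself), $\underline m(C)=\sum_{v\in C}m(v)$, and $\underline a(C,D)=\sum_{v\in C,\,w\in D}a(v,w)$, with edges the pairs $(C,D)$ such that $\underline a(C,D)>0$. Let $\underline L$ be the Laplacian, given by the formula above, of this reduced graph $\underline G$ (which need not be locally finite, but has finite masses and bounded degrees). Define bounded operators $J_\downarrow:\ell^2(G)\to\ell^2(\underline G)$ and $J_\uparrow:\ell^2(\underline G)\to\ell^2(G)$ by $$(J_\downarrow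 f)(C)=\frac{\langle\chi_C,f\rangle}{\underline m(C)},\qquad J_\uparrow g=\sum_{C\in\underline V}g(C)\,\chi_C .$$ **Statement.** For every $t>0$, $e^{-tL_\beta}\to J_\uparrow e^{-t\underline L}J_\downarrow$ strongly as $\beta\to\infty$; that is, for every $f\in\ell^2(G)$, $$\lim_{\beta\to\infty}\big\|e^{-tL_\beta}f-J_\uparrow e^{-t\underline L}J_\downarrow f\big\|_{\ell^2(G)}=0 .$$ -/

import Mathlib

open MeasureTheory Filter Topology
open scoped NNReal ENNReal

/-- The measure on the discrete space `V` giving the point `v` the mass `m v`. -/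
noncomputable def massMeasure {V : Type*} (m : V → ℝ) : @Measure V ⊤ :=
  @Measure.sum V V ⊤ fun v => ENNReal.ofReal (m v) • @Measure.dirac V ⊤ v

/-- The weighted space `ℓ²(V, m)` of functions `f : V → ℂ` with `∑ v, |f v|² m v < ∞`, as the
`L²`-space of the discrete measure with masses `m`; its inner product is
`∑ v, conj (f v) * g v * m v`. Since all masses will be positive, almost everywhere equal functions
are equal. -/
abbrev weightedEll2 {V : Type*} (m : V → ℝ) : Type _ := @Lp V ℂ ⊤ _ 2 (massMeasure m)

theorem massMeasure_lintegral {V : Type*} (m : V → ℝ) (f : V → ℝ≥0∞) :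
    @lintegral V ⊤ (massMeasure m) f = ∑' v, ENNReal.ofReal (m v) * f v := by
  let _ : MeasurableSpace V := ⊤
  unfold massMeasure
  rw [lintegral_sum_measure]
  simp [lintegral_smul_measure]

theorem massMeasure_apply {V : Type*} (m : V → ℝ) (s : Set V) :
    massMeasure m s = ∑' v : s, ENNReal.ofReal (m v) := by
  let _ : MeasurableSpace V := ⊤
  have : massMeasure m s = ∫⁻ v, s.indicator 1 v ∂(massMeasure m) := by
    rw [lintegral_indicator_one MeasurableSpace.measurableSet_top]
  rw [this, massMeasure_lintegral, tsum_subtype s (fun v => ENNReal.ofReal (m v))]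
  congr 1; ext v
  by_cases h : v ∈ s <;> simp [h]

theorem ae_massMeasure {V : Type*} {m : V → ℝ} (hm : ∀ v, 0 < m v) {p : V → Prop} :
    (∀ᵐ v ∂(massMeasure m), p v) ↔ ∀ v, p v := by
  let _ : MeasurableSpace V := ⊤
  refine ⟨fun h v => ?_, fun h => Eventually.of_forall h⟩
  by_contra hv
  have h0 : massMeasure m {v | ¬ p v} = 0 := h
  rw [massMeasure_apply, ENNReal.tsum_eq_zero] at h0
  have := h0 ⟨v, hv⟩
  simp only [ENNReal.ofReal_eq_zero] at this
  exact absurd (hm v) (not_lt.2 this)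

theorem aestronglyMeasurable_discrete {V : Type*} (m : V → ℝ) (f : V → ℂ) :
    @AEStronglyMeasurable V ℂ _ ⊤ ⊤ f (massMeasure m) := by
  let _ : MeasurableSpace V := ⊤
  exact measurable_from_top.aestronglyMeasurable

theorem memLp_massMeasure_iff {V : Type*} {m : V → ℝ} (f : V → ℂ) :
    @MemLp V ℂ ⊤ _ _ f 2 (massMeasure m) ↔
      ∑' v, ENNReal.ofReal (m v) * ‖f v‖ₑ ^ 2 ≠ (∞ : ℝ≥0∞) := by
  let _ : MeasurableSpace V := ⊤
  have : @MemLp V ℂ ⊤ _ _ f 2 (massMeasure m) ↔ eLpNorm f 2 (massMeasure m) < ∞ :=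
   ⟨fun h => h.2, fun h => ⟨aestronglyMeasurable_discrete m f, h⟩⟩
  rw [this, eLpNorm_lt_top_iff_lintegral_rpow_enorm_lt_top (by norm_num) (by norm_num), massMeasure_lintegral]
  simp [lt_top_iff_ne_top]

theorem eLpNorm_massMeasure {V : Type*} {m : V → ℝ} (f : V → ℂ) :
    @eLpNorm V ℂ _ ⊤ f 2 (massMeasure m) ^ 2 =
      ∑' v, ENNReal.ofReal (m v) * ‖f v‖ₑ ^ 2  := by
  let _ : MeasurableSpace V := ⊤
  have h := eLpNorm_nnreal_pow_eq_lintegral (f := f) (μ := massMeasure m) (p := 2) (by norm_num)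
  rw [massMeasure_lintegral] at h
  simpa using h

theorem ennreal_tsum_mul_sq_le {ι : Type*} (w g : ι → ℝ≥0∞) :
    (∑' y, w y * g y) ^ 2 ≤ (∑' y, w y) * ∑' y, w y * g y ^ 2 := by
  let _ : MeasurableSpace ι := ⊤
  have h := ENNReal.lintegral_mul_le_Lp_mul_Lq (Measure.count : Measure ι) (p := 2) (q := 2)
    Real.HolderConjugate.two_two
    (f := fun y => (w y) ^ (1/2 : ℝ)) (g := fun y => (w y) ^ (1/2 : ℝ) * g y)
    measurable_from_top.aemeasurable measurable_from_top.aemeasurable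
  simp only [lintegral_count, Pi.mul_apply] at h
  have e1 : ∀ y, (w y) ^ (1/2 : ℝ) * ((w y) ^ (1/2 : ℝ) * g y) = w y * g y := by
    intro y
    rw [← mul_assoc, ← ENNReal.rpow_add_of_nonneg _ _ (by norm_num) (by norm_num)]; norm_num
  have e2 : ∀ y, ((w y) ^ (1/2 : ℝ)) ^ (2:ℝ) = w y := by
    intro y; rw [← ENNReal.rpow_mul]; norm_num
  have e3 : ∀ y, ((w y) ^ (1/2 : ℝ) * g y) ^ (2:ℝ) = w y * g y ^ 2 := by
    intro y
    rw [ENNReal.mul_rpow_of_nonneg _ _ (by norm_num), e2]; norm_cast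
  simp only [e1, e2, e3] at h
  calc _ ≤ _ := pow_le_pow_left' h 2
    _ = _ := by
      rw [mul_pow, ← ENNReal.rpow_natCast, ← ENNReal.rpow_natCast, ← ENNReal.rpow_mul, ← ENNReal.rpow_mul]; norm_num

/-- A weighted (possibly directed) graph on the vertex set `V`: positive vertex masses `m`, a set of
edges `E` and a nonnegative edge weight function `a` whose support is `E`. Countability of `V` and
local finiteness of `E` are imposed separately. -/
structure WeightedGraph (V : Type*) where
  m : V → ℝ
  m_pos : ∀ v, 0 < m v
  E : Set (V × V)
  a : V → V → ℝ
  a_nonneg : ∀ v w, 0 ≤ a v w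
  a_pos_iff : ∀ v w, 0 < a v w ↔ (v, w) ∈ E

namespace WeightedGraph

variable {V : Type*}

/-- The graph with all edges reversed. -/
def transpose (G : WeightedGraph V) : WeightedGraph V where
  m := G.m
  m_pos := G.m_pos
  E := {p | (p.2, p.1) ∈ G.E}
  a v w := G.a w v
  a_nonneg v w := G.a_nonneg w v
  a_pos_iff v w := G.a_pos_iff w v

/-- A graph is undirected if it equals its transpose. -/
def IsUndirected (G : WeightedGraph V) : Prop := G = G.transpose

/-- Every vertex lies on only finitely many edges. -/
def LocallyFinite (G : WeightedGraph V) : Prop :=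
  ∀ v, {w | (v, w) ∈ G.E}.Finite ∧ {w | (w, v) ∈ G.E}.Finite

/-- The in-degree `d⁻(v) = ∑ i, a(v, i)`. -/
noncomputable def inDegree (G : WeightedGraph V) (v : V) : ℝ := ∑' i, G.a v i

/-- The out-degree `d⁺(v) = ∑ j, a(j, v)`. -/
noncomputable def outDegree (G : WeightedGraph V) (v : V) : ℝ := ∑' j, G.a j v

/-- In- and out-degrees are finite and bounded by `C` times the mass. -/
def BoundedDegreesBy (G : WeightedGraph V) (C : ℝ) : Prop :=
  ∀ v, (Summable (fun i => G.a v i) ∧ G.inDegree v ≤ C * G.m v) ∧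
    (Summable (fun j => G.a j v) ∧ G.outDegree v ≤ C * G.m v)

/-- In- and out-degrees are uniformly bounded relative to the vertex mass. -/
def BoundedDegrees (G : WeightedGraph V) : Prop := ∃ C > 0, G.BoundedDegreesBy C

/-- The Hilbert space `ℓ²(G)`. -/
abbrev ell2 (G : WeightedGraph V) : Type _ := weightedEll2 G.m

theorem ext_ell2 {G : WeightedGraph V} {f g : G.ell2} (h : ∀ v, f v = g v) : f = g :=
  Lp.ext (Eventually.of_forall h)

theorem toLp_apply (G : WeightedGraph V) {f : V → ℂ}
    (hf : @MemLp V ℂ ⊤ _ _ f 2 (massMeasure G.m)) (v : V) : (hf.toLp f : G.ell2) v = f v :=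
  (ae_massMeasure G.m_pos).1 hf.coeFn_toLp v

theorem add_apply (G : WeightedGraph V) (f g : G.ell2) (v : V) : (f + g) v = f v + g v :=
  (ae_massMeasure G.m_pos).1 (Lp.coeFn_add f g) v

theorem smul_apply (G : WeightedGraph V) (c : ℂ) (f : G.ell2) (v : V) : (c • f) v = c * f v :=
  (ae_massMeasure G.m_pos).1 (Lp.coeFn_smul c f) v

/-- The pointwise action of the (in-degree) Laplacian,
`(L f)(x) = (d⁻(x) f(x) - ∑ y, a(x, y) f(y)) / m(x)`. -/
noncomputable def inLaplacianFun (G : WeightedGraph V) (f : V → ℂ) (x : V) : ℂ :=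
  1 / (G.m x : ℂ) * ((G.inDegree x : ℂ) * f x - ∑' y, (G.a x y : ℂ) * f y)

theorem row_le (G : WeightedGraph V) {C : ℝ} (hC : 0 < C) (h : G.BoundedDegreesBy C)
    (x : V) : ∑' y, ENNReal.ofReal (G.a x y) ≤ ENNReal.ofReal C * ENNReal.ofReal (G.m x) := by
  rw [← ENNReal.ofReal_tsum_of_nonneg (G.a_nonneg x) (h x).1.1, ← ENNReal.ofReal_mul hC.le]
  exact ENNReal.ofReal_le_ofReal (h x).1.2

theorem col_le (G : WeightedGraph V) {C : ℝ} (hC : 0 < C) (h : G.BoundedDegreesBy C)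
    (y : V) : ∑' x, ENNReal.ofReal (G.a x y) ≤ ENNReal.ofReal C * ENNReal.ofReal (G.m y) := by
  rw [← ENNReal.ofReal_tsum_of_nonneg (fun x => G.a_nonneg x y) (h y).2.1, ← ENNReal.ofReal_mul hC.le]
  exact ENNReal.ofReal_le_ofReal (h y).2.2

theorem double_le (G : WeightedGraph V) {C : ℝ} (hC : 0 < C) (h : G.BoundedDegreesBy C)
    (g : V → ℝ≥0∞) :
    ∑' x, ∑' y, ENNReal.ofReal (G.a x y) * g y ≤
      ENNReal.ofReal C * ∑' y, ENNReal.ofReal (G.m y) * g y := by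
  rw [ENNReal.tsum_comm, ← ENNReal.tsum_mul_left]
  refine ENNReal.tsum_le_tsum fun y => ?_
  rw [ENNReal.tsum_mul_right, ← mul_assoc]
  gcongr
  exact G.col_le hC h y

theorem adj_sq_le (G : WeightedGraph V) {C : ℝ} (hC : 0 < C) (h : G.BoundedDegreesBy C)
    (f : V → ℂ) (x : V) :
    (∑' y, ENNReal.ofReal (G.a x y) * ‖f y‖ₑ) ^ 2 ≤
      ENNReal.ofReal C * ENNReal.ofReal (G.m x) * ∑' y, ENNReal.ofReal (G.a x y) * ‖f y‖ₑ ^ 2 :=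
  (ennreal_tsum_mul_sq_le _ _).trans (by gcongr; exact G.row_le hC h x)

theorem summable_adj (G : WeightedGraph V) {C : ℝ} (hC : 0 < C) (h : G.BoundedDegreesBy C)
    (f : G.ell2) (x : V) : Summable fun y => (G.a x y : ℂ) * f y := by
  have hf := (memLp_massMeasure_iff (m := G.m) f).1 (Lp.memLp f)
  have h1 : ∑' y, ENNReal.ofReal (G.a x y) * ‖f y‖ₑ ^ 2 ≠ (∞ : ℝ≥0∞) := by
    refine ne_top_of_le_ne_top ?_ ((ENNReal.le_tsum x).trans (G.double_le hC h fun y => ‖f y‖ₑ ^ 2))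
    exact ENNReal.mul_ne_top ENNReal.ofReal_ne_top hf
  have h2 : ∑' y, ENNReal.ofReal (G.a x y) * ‖f y‖ₑ ≠ (∞ : ℝ≥0∞) := by
    intro h3
    have := G.adj_sq_le hC h f x
    rw [h3] at this
    exact ENNReal.mul_ne_top (ENNReal.mul_ne_top ENNReal.ofReal_ne_top ENNReal.ofReal_ne_top) h1
      (top_unique (by simpa using this))
  refine Summable.of_norm ?_
  have := ENNReal.summable_toReal h2
  refine this.congr fun y => ?_
  simp [ENNReal.toReal_mul, ENNReal.toReal_ofReal (G.a_nonneg x y), abs_of_nonneg (G.a_nonneg x y)]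

theorem enorm_adj_le (G : WeightedGraph V) (f : V → ℂ) (x : V) :
    ‖1 / (G.m x : ℂ) * ∑' y, (G.a x y : ℂ) * f y‖ₑ ≤
      (ENNReal.ofReal (G.m x))⁻¹ * ∑' y, ENNReal.ofReal (G.a x y) * ‖f y‖ₑ := by
  rw [enorm_mul]
  have e1 : ‖1 / (G.m x : ℂ)‖ₑ = (ENNReal.ofReal (G.m x))⁻¹ := by
    rw [← ofReal_norm, ← ENNReal.ofReal_inv_of_pos (G.m_pos x)]
    simp [abs_of_pos (G.m_pos x)]
  rw [e1]
  gcongr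
  refine (enorm_tsum_le_tsum_enorm).trans (le_of_eq ?_)
  refine tsum_congr fun y => ?_
  rw [enorm_mul]
  congr 1
  rw [← ofReal_norm]
  simp [abs_of_nonneg (G.a_nonneg x y)]

theorem eLpNorm_adj_le (G : WeightedGraph V) {C : ℝ} (hC : 0 < C) (h : G.BoundedDegreesBy C)
    (f : V → ℂ) :
    @eLpNorm V ℂ _ ⊤ (fun x => 1 / (G.m x : ℂ) * ∑' y, (G.a x y : ℂ) * f y) 2 (massMeasure G.m) ≤
      ENNReal.ofReal C * @eLpNorm V ℂ _ ⊤ f 2 (massMeasure G.m) := by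
  rw [← ENNReal.pow_le_pow_left_iff (n := 2) (by norm_num), mul_pow, eLpNorm_massMeasure, eLpNorm_massMeasure]
  calc _ ≤ ∑' x, ENNReal.ofReal C * ∑' y, ENNReal.ofReal (G.a x y) * ‖f y‖ₑ ^ 2 := by
        refine ENNReal.tsum_le_tsum fun x => ?_
        set M := ENNReal.ofReal (G.m x) with hM
        have hM0 : M ≠ 0 := by simpa [hM] using G.m_pos x
        have hMt : M ≠ ∞ := ENNReal.ofReal_ne_top
        calc _ ≤ M * (M⁻¹ * ∑' y, ENNReal.ofReal (G.a x y) * ‖f y‖ₑ) ^ 2 := by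
              gcongr; exact G.enorm_adj_le f x
          _ ≤ M * (M⁻¹ ^ 2 * (ENNReal.ofReal C * M * ∑' y, ENNReal.ofReal (G.a x y) * ‖f y‖ₑ ^ 2)) := by
              rw [mul_pow]; gcongr; exact G.adj_sq_le hC h f x
          _ = (M * M⁻¹) * (M * M⁻¹) * (ENNReal.ofReal C * ∑' y, ENNReal.ofReal (G.a x y) * ‖f y‖ₑ ^ 2) := by ring
          _ = _ := by rw [ENNReal.mul_inv_cancel hM0 hMt]; ring
    _ = ENNReal.ofReal C * ∑' x, ∑' y, ENNReal.ofReal (G.a x y) * ‖f y‖ₑ ^ 2 := ENNReal.tsum_mul_left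
    _ ≤ ENNReal.ofReal C * (ENNReal.ofReal C * ∑' y, ENNReal.ofReal (G.m y) * ‖f y‖ₑ ^ 2) := by
        gcongr; exact G.double_le hC h _
    _ = _ := by ring

theorem eLpNorm_diag_le (G : WeightedGraph V) {C : ℝ} (h : G.BoundedDegreesBy C)
    (f : V → ℂ) :
    @eLpNorm V ℂ _ ⊤ (fun x => 1 / (G.m x : ℂ) * ((G.inDegree x : ℂ) * f x)) 2 (massMeasure G.m) ≤
      ENNReal.ofReal C * @eLpNorm V ℂ _ ⊤ f 2 (massMeasure G.m) := by
  let _ : MeasurableSpace V := ⊤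
  refine eLpNorm_le_mul_eLpNorm_of_ae_le_mul (Eventually.of_forall fun x => ?_) 2
  have h0 : 0 ≤ G.inDegree x := tsum_nonneg (G.a_nonneg x)
  rw [norm_mul, norm_mul, ← mul_assoc]
  gcongr
  simp only [one_div, norm_inv, Complex.norm_real, Real.norm_eq_abs, abs_of_pos (G.m_pos x),
    abs_of_nonneg h0]
  rw [inv_mul_le_iff₀ (G.m_pos x), mul_comm]
  exact (h x).1.2

theorem eLpNorm_inLaplacianFun_le (G : WeightedGraph V) {C : ℝ} (hC : 0 < C) (h : G.BoundedDegreesBy C)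
    (f : V → ℂ) :
    @eLpNorm V ℂ _ ⊤ (G.inLaplacianFun f) 2 (massMeasure G.m) ≤
      ENNReal.ofReal (2 * C) * @eLpNorm V ℂ _ ⊤ f 2 (massMeasure G.m) := by
  let _ : MeasurableSpace V := ⊤
  have e : G.inLaplacianFun f = (fun x => 1 / (G.m x : ℂ) * ((G.inDegree x : ℂ) * f x)) -
      (fun x => 1 / (G.m x : ℂ) * ∑' y, (G.a x y : ℂ) * f y) := by
    ext x; simp [inLaplacianFun, mul_sub]
  rw [e]
  refine (eLpNorm_sub_le (aestronglyMeasurable_discrete _ _) (aestronglyMeasurable_discrete _ _) (by norm_num)).trans ?_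
  refine (add_le_add (G.eLpNorm_diag_le h f) (G.eLpNorm_adj_le hC h f)).trans (le_of_eq ?_)
  rw [ENNReal.ofReal_mul (by norm_num)]
  simp; ring

theorem memLp_inLaplacianFun (G : WeightedGraph V) {C : ℝ} (hC : 0 < C) (h : G.BoundedDegreesBy C)
    (f : G.ell2) :
    @MemLp V ℂ ⊤ _ _ (G.inLaplacianFun f) 2 (massMeasure G.m) :=
  ⟨aestronglyMeasurable_discrete _ _, (G.eLpNorm_inLaplacianFun_le hC h f).trans_lt
    (ENNReal.mul_lt_top ENNReal.ofReal_lt_top (Lp.memLp f).2)⟩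


theorem BoundedDegrees.memLp {G : WeightedGraph V} (hG : G.BoundedDegrees) (f : G.ell2) :
    @MemLp V ℂ ⊤ _ _ (G.inLaplacianFun f) 2 (massMeasure G.m) := by
  obtain ⟨C, hC, h⟩ := hG
  exact G.memLp_inLaplacianFun hC h f

theorem BoundedDegrees.summable {G : WeightedGraph V} (hG : G.BoundedDegrees) (f : G.ell2) (x : V) :
    Summable fun y => (G.a x y : ℂ) * f y := by
  obtain ⟨C, hC, h⟩ := hG
  exact G.summable_adj hC h f x

/-- The graph Laplacian as a bounded operator on `ℓ²(G)`, for a graph with bounded degrees. (For an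
undirected graph the in- and out-degree Laplacians coincide.) -/
noncomputable def laplacian (G : WeightedGraph V) (hG : G.BoundedDegrees) : G.ell2 →L[ℂ] G.ell2 :=
  LinearMap.mkContinuousOfExistsBound
    { toFun := fun f => (hG.memLp f).toLp (G.inLaplacianFun f)
      map_add' := fun f g => by
        refine ext_ell2 fun x => ?_
        simp only [add_apply, toLp_apply, inLaplacianFun, mul_add]
        rw [(hG.summable f x).tsum_add (hG.summable g x)]
        ring
      map_smul' := fun c f => by
        refine ext_ell2 fun x => ?_
        simp only [smul_apply, toLp_apply, inLaplacianFun, RingHom.id_apply]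
        rw [tsum_congr fun y => mul_left_comm (G.a x y : ℂ) c (f y), tsum_mul_left]
        ring }
    (by
      obtain ⟨C, hC, h⟩ := id hG
      refine ⟨2 * C, fun f => ?_⟩
      have h1 := G.eLpNorm_inLaplacianFun_le hC h f
      change ‖(hG.memLp f).toLp (G.inLaplacianFun f)‖ ≤ _
      rw [Lp.norm_toLp, Lp.norm_def]
      refine (ENNReal.toReal_mono (ENNReal.mul_ne_top ENNReal.ofReal_ne_top (Lp.eLpNorm_ne_top f)) h1).trans (le_of_eq ?_)
      rw [ENNReal.toReal_mul, ENNReal.toReal_ofReal (by positivity)])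

theorem laplacian_apply (G : WeightedGraph V) (hG : G.BoundedDegrees) (f : G.ell2) (x : V) :
    G.laplacian hG f x = 1 / (G.m x : ℂ) * ((G.inDegree x : ℂ) * f x - ∑' y, (G.a x y : ℂ) * f y) :=
  toLp_apply G (hG.memLp f) x

/-- The heat semigroup `exp (-t L)` on `ℓ²(G)`. -/
noncomputable def heatSemigroup (G : WeightedGraph V) (hG : G.BoundedDegrees) (t : ℝ) :
    G.ell2 →L[ℂ] G.ell2 :=
  NormedSpace.exp (-(t : ℂ) • G.laplacian hG)

/-- `v` sees `w` along edges in `F`: there is a (possibly empty) path of edges in `F`. -/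
def Sees (F : Set (V × V)) : V → V → Prop := Relation.ReflTransGen fun v w => (v, w) ∈ F

/-- The vertices on the edges of a symmetric edge set `F`. -/
def nodeSet (F : Set (V × V)) : Set V := {v | ∃ w, (v, w) ∈ F}

/-- A collection of undirected clusters: a family of symmetric edge sets contained in `G.E`, each of
finite total vertex mass, pairwise vertex-disjoint, and each connected. -/
structure Clusters (G : WeightedGraph V) (I : Type*) where
  edges : I → Set (V × V)
  edges_subset : ∀ i, edges i ⊆ G.E
  edges_symm : ∀ i v w, (v, w) ∈ edges i → (w, v) ∈ edges i
  mass_finite : ∀ i, Summable fun v : nodeSet (edges i) => G.m v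
  node_disjoint : ∀ i j, i ≠ j → Disjoint (nodeSet (edges i)) (nodeSet (edges j))
  connected : ∀ i, ∀ v ∈ nodeSet (edges i), ∀ w ∈ nodeSet (edges i), Sees (edges i) v w

/-- Aggregation of edge weights along `q : V → W`: `∑ a(v, w)` over all `v` in the fibre of `C` and
`w` in the fibre of `D`. -/
noncomputable def aggregate {W : Type*} (q : V → W) (a : V → V → ℝ) (C D : W) : ℝ :=
  ∑' p : {v // q v = C} × {w // q w = D}, a p.1 p.2

theorem aggregate_bound {W : Type*} (q : V → W) (a : V → V → ℝ) (ha : ∀ v w, 0 ≤ a v w)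
    (m : V → ℝ) (hm : ∀ v, 0 < m v) {c : ℝ} (hc : 0 < c)
    (hs : ∀ v, Summable (a v)) (hb : ∀ v, ∑' w, a v w ≤ c * m v) (C : W)
    (hC : Summable fun v : {v // q v = C} => m v) :
    Summable (fun D => aggregate q a C D) ∧
      ∑' D, aggregate q a C D ≤ c * ∑' v : {v // q v = C}, m v := by
  have key : ∑' D, ∑' p : {v // q v = C} × {w // q w = D}, ENNReal.ofReal (a p.1 p.2) ≤
      ENNReal.ofReal (c * ∑' v : {v // q v = C}, m v) := by
    calc _ = ∑' v : {v // q v = C}, ∑' w, ENNReal.ofReal (a v w) := by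
          simp_rw [ENNReal.tsum_prod']
          rw [ENNReal.tsum_comm]
          refine tsum_congr fun v => ?_
          rw [← ENNReal.tsum_sigma' (fun x : (D : W) × {w // q w = D} => ENNReal.ofReal (a v x.2))]
          exact (Equiv.sigmaFiberEquiv q).tsum_eq fun w => ENNReal.ofReal (a v w)
      _ ≤ ∑' v : {v // q v = C}, ENNReal.ofReal (c * m v) := by
          refine ENNReal.tsum_le_tsum fun v => ?_
          rw [← ENNReal.ofReal_tsum_of_nonneg (ha v) (hs v)]
          exact ENNReal.ofReal_le_ofReal (hb v)
      _ = _ := by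
          rw [← tsum_mul_left]
          exact (ENNReal.ofReal_tsum_of_nonneg (f := fun v : {v // q v = C} => c * m v)
            (fun v => (mul_pos hc (hm v)).le) (hC.mul_left c)).symm
  have fin := ne_top_of_le_ne_top ENNReal.ofReal_ne_top key
  have e : ∀ D, aggregate q a C D =
      (∑' p : {v // q v = C} × {w // q w = D}, ENNReal.ofReal (a p.1 p.2)).toReal := by
    intro D
    rw [ENNReal.tsum_toReal_eq fun _ => ENNReal.ofReal_ne_top]
    exact tsum_congr fun p => (ENNReal.toReal_ofReal (ha _ _)).symm
  simp_rw [e]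
  refine ⟨ENNReal.summable_toReal fin, ?_⟩
  rw [← ENNReal.tsum_toReal_eq fun D => ne_top_of_le_ne_top fin (ENNReal.le_tsum D)]
  refine ENNReal.toReal_le_of_le_ofReal (mul_nonneg hc.le (tsum_nonneg fun v => (hm v).le)) key

theorem aggregate_swap {W : Type*} (q : V → W) (a : V → V → ℝ) (C D : W) :
    aggregate q a C D = aggregate q (fun v w => a w v) D C :=
  (Equiv.prodComm _ _).tsum_eq fun p : {v // q v = D} × {w // q w = C} => a p.2 p.1

namespace Clusters

variable {G : WeightedGraph V} {I : Type*}

/-- The union of all cluster edge sets. -/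
def totalEdges (K : G.Clusters I) : Set (V × V) := ⋃ i, K.edges i

theorem totalEdges_symm (K : G.Clusters I) {v w : V} (h : (v, w) ∈ K.totalEdges) :
    (w, v) ∈ K.totalEdges := by
  obtain ⟨i, hi⟩ := Set.mem_iUnion.1 h
  exact Set.mem_iUnion.2 ⟨i, K.edges_symm i v w hi⟩

/-- Two vertices are equivalent if they are joined by a path of cluster edges. -/
def setoid (K : G.Clusters I) : Setoid V where
  r := Sees K.totalEdges
  iseqv :=
    { refl := fun _ => Relation.ReflTransGen.refl
      symm := fun h => by
        induction h with
        | refl => exact Relation.ReflTransGen.refl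
        | tail _ hbc ih => exact Relation.ReflTransGen.head (K.totalEdges_symm hbc) ih
      trans := Relation.ReflTransGen.trans }

/-- The connected components of `V` with respect to the cluster edges (a vertex on no cluster edge is
a component by itself). -/
abbrev Component (K : G.Clusters I) : Type _ := Quotient K.setoid

/-- The component of a vertex. -/
def component (K : G.Clusters I) (v : V) : K.Component := Quotient.mk K.setoid v

theorem summable_component (K : G.Clusters I) (C : K.Component) :
    Summable fun v : {v // K.component v = C} => G.m v := by
  induction C using Quotient.inductionOn with | _ x =>
  by_cases hx : ∃ i, x ∈ nodeSet (K.edges i)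
  · obtain ⟨i, hi⟩ := hx
    have sub : ∀ y, Sees K.totalEdges x y → y ∈ nodeSet (K.edges i) := by
      intro y hy
      induction hy with
      | refl => exact hi
      | @tail b c _ hbc ih =>
        obtain ⟨j, hj⟩ := Set.mem_iUnion.1 hbc
        have hij : i = j := by
          by_contra hne
          exact Set.disjoint_left.1 (K.node_disjoint i j hne) ih ⟨c, hj⟩
        subst hij
        exact ⟨b, K.edges_symm i b c hj⟩
    have sub' : {v | K.component v = Quotient.mk K.setoid x} ⊆ nodeSet (K.edges i) :=
      fun y hy => sub y (K.setoid.symm (Quotient.exact hy))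
    exact (K.mass_finite i).comp_injective (Set.inclusion_injective sub')
  · have sub : ∀ y, Sees K.totalEdges x y → y = x := by
      intro y hy
      rcases Relation.ReflTransGen.cases_head hy with h | ⟨c, hc, _⟩
      · exact h.symm
      · obtain ⟨j, hj⟩ := Set.mem_iUnion.1 hc
        exact absurd ⟨j, c, hj⟩ hx
    have : Subsingleton {v // K.component v = Quotient.mk K.setoid x} :=
      ⟨fun y z => Subtype.ext <| (sub y (K.setoid.symm (Quotient.exact y.2))).trans
        (sub z (K.setoid.symm (Quotient.exact z.2))).symm⟩
    have := Finite.of_subsingleton (α := {v // K.component v = Quotient.mk K.setoid x})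
    exact Summable.of_finite

/-- The reduced graph: its vertices are the components, its masses and edge weights are the sums of the
original ones, its edges are the support of the weights. -/
noncomputable def reduced (K : G.Clusters I) : WeightedGraph K.Component where
  m C := ∑' v : {v // K.component v = C}, G.m v
  m_pos C := by
    obtain ⟨x, hx⟩ := Quotient.exists_rep C
    exact (K.summable_component C).tsum_pos (fun v => (G.m_pos v).le) ⟨x, hx⟩ (G.m_pos x)
  E := {p | 0 < aggregate K.component G.a p.1 p.2}
  a := aggregate K.component G.a
  a_nonneg C D := tsum_nonneg fun p => G.a_nonneg _ _
  a_pos_iff C D := Iff.rfl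

theorem reduced_boundedDegrees (K : G.Clusters I) (hG : G.BoundedDegrees) :
    K.reduced.BoundedDegrees := by
  obtain ⟨c, hc, h⟩ := hG
  refine ⟨c, hc, fun C => ⟨?_, ?_⟩⟩
  · exact aggregate_bound K.component G.a G.a_nonneg G.m G.m_pos hc (fun v => (h v).1.1)
      (fun v => (h v).1.2) C (K.summable_component C)
  · have := aggregate_bound K.component (fun v w => G.a w v) (fun v w => G.a_nonneg w v) G.m
      G.m_pos hc (fun v => (h v).2.1) (fun v => (h v).2.2) C (K.summable_component C)
    simp_rw [← aggregate_swap] at this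
    exact this

theorem measurePreserving (K : G.Clusters I) :
    @MeasurePreserving V K.Component ⊤ ⊤ K.component (massMeasure G.m)
      (massMeasure K.reduced.m) := by
  let _ : MeasurableSpace V := ⊤
  let _ : MeasurableSpace K.Component := ⊤
  refine ⟨measurable_from_top, Measure.ext fun s hs => ?_⟩
  rw [Measure.map_apply measurable_from_top hs, ← lintegral_indicator_one hs,
    ← lintegral_indicator_one MeasurableSpace.measurableSet_top, massMeasure_lintegral,
    massMeasure_lintegral, ← (Equiv.sigmaFiberEquiv K.component).tsum_eq, ENNReal.tsum_sigma']
  refine tsum_congr fun C => ?_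
  change _ = ENNReal.ofReal (∑' v : {v // K.component v = C}, G.m v) * _
  rw [ENNReal.ofReal_tsum_of_nonneg (f := fun v : {v // K.component v = C} => G.m v)
    (fun v => (G.m_pos v).le) (K.summable_component C), ← ENNReal.tsum_mul_right]
  refine tsum_congr fun v => ?_
  have : K.component v = C := v.2
  have hv : (v : V) ∈ K.component ⁻¹' s ↔ C ∈ s := by rw [Set.mem_preimage, this]
  by_cases h : C ∈ s <;> simp [Equiv.sigmaFiberEquiv, Set.indicator, hv, h]

theorem massMeasure_component (K : G.Clusters I) (C : K.Component) :
    massMeasure G.m {v | K.component v = C} = ENNReal.ofReal (K.reduced.m C) := by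
  rw [massMeasure_apply]
  exact (ENNReal.ofReal_tsum_of_nonneg (f := fun v : {v // K.component v = C} => G.m v)
    (fun v => (G.m_pos v).le) (K.summable_component C)).symm

/-- The characteristic function of a component, as an element of `ℓ²(G)`. -/
noncomputable def indicator (K : G.Clusters I) (C : K.Component) : G.ell2 :=
  indicatorConstLp 2 (MeasurableSpace.measurableSet_top (s := {v | K.component v = C}))
    (by rw [K.massMeasure_component C]; exact ENNReal.ofReal_ne_top) 1

open Classical in
theorem indicator_apply (K : G.Clusters I) (C : K.Component) (v : V) :
    K.indicator C v = if K.component v = C then 1 else 0 := by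
  have := (ae_massMeasure G.m_pos).1 (indicatorConstLp_coeFn (p := 2)
    (hs := MeasurableSpace.measurableSet_top (s := {v | K.component v = C}))
    (hμs := by rw [K.massMeasure_component C]; exact ENNReal.ofReal_ne_top) (c := (1 : ℂ))) v
  refine this.trans ?_
  by_cases h : K.component v = C <;> simp [Set.indicator, h]

/-- The interpolation operator `J↑ g = ∑ C, g(C) χ_C`, that is, `(J↑ g)(v) = g([v])`. -/
noncomputable def interpolation (K : G.Clusters I) : K.reduced.ell2 →L[ℂ] G.ell2 :=
  letI : MeasurableSpace V := ⊤
  letI : MeasurableSpace K.Component := ⊤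
  (Lp.compMeasurePreservingₗᵢ ℂ K.component K.measurePreserving).toContinuousLinearMap

theorem interpolation_apply (K : G.Clusters I) (g : K.reduced.ell2) (v : V) :
    K.interpolation g v = g (K.component v) :=
  letI : MeasurableSpace V := ⊤
  letI : MeasurableSpace K.Component := ⊤
  (ae_massMeasure G.m_pos).1 (Lp.coeFn_compMeasurePreserving g K.measurePreserving) v

theorem adjoint_apply (K : G.Clusters I) (f : G.ell2) (C : K.Component) :
    ContinuousLinearMap.adjoint K.interpolation f C =
      inner ℂ (K.indicator C) f / (K.reduced.m C : ℂ) := by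
  let _ : MeasurableSpace K.Component := ⊤
  have hμ : massMeasure K.reduced.m {C} = ENNReal.ofReal (K.reduced.m C) := by
    rw [massMeasure_apply, tsum_subtype _ (fun v => ENNReal.ofReal (K.reduced.m v)),
      tsum_eq_single C (fun D hD => by simp [hD])]
    simp
  let δ : K.reduced.ell2 := indicatorConstLp 2 (MeasurableSpace.measurableSet_top (s := {C}))
    (by rw [hμ]; exact ENNReal.ofReal_ne_top) 1
  have hδ : K.interpolation δ = K.indicator C := by
    refine ext_ell2 fun v => ?_
    rw [interpolation_apply, indicator_apply]
    have := (ae_massMeasure K.reduced.m_pos).1 (indicatorConstLp_coeFn (p := 2)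
      (hs := MeasurableSpace.measurableSet_top (s := {C}))
      (hμs := by rw [hμ]; exact ENNReal.ofReal_ne_top) (c := (1 : ℂ))) (K.component v)
    refine this.trans ?_
    by_cases h : K.component v = C <;> simp [Set.indicator, h]
  rw [← hδ, ← ContinuousLinearMap.adjoint_inner_right, L2.inner_indicatorConstLp_one,
    integral_singleton]
  have h0 : (K.reduced.m C : ℂ) ≠ 0 := by exact_mod_cast (K.reduced.m_pos C).ne'
  rw [Measure.real, hμ, ENNReal.toReal_ofReal (K.reduced.m_pos C).le, Complex.real_smul]
  field_simp

theorem memLp_projection (K : G.Clusters I) (f : G.ell2) :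
    @MemLp K.Component ℂ ⊤ _ _ (fun C => inner ℂ (K.indicator C) f / (K.reduced.m C : ℂ)) 2
      (massMeasure K.reduced.m) := by
  have := Lp.memLp (ContinuousLinearMap.adjoint K.interpolation f)
  rwa [funext (K.adjoint_apply f)] at this

/-- The projection operator `(J↓ f)(C) = ⟨χ_C, f⟩ / m(C)`. -/
noncomputable def projection (K : G.Clusters I) : G.ell2 →L[ℂ] K.reduced.ell2 :=
  LinearMap.mkContinuousOfExistsBound
    { toFun := fun f => (K.memLp_projection f).toLp
        fun C => inner ℂ (K.indicator C) f / (K.reduced.m C : ℂ)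
      map_add' := fun f g => by
        refine ext_ell2 fun C => ?_
        rw [add_apply, toLp_apply, toLp_apply, toLp_apply, inner_add_right, add_div]
      map_smul' := fun c f => by
        refine ext_ell2 fun C => ?_
        rw [RingHom.id_apply, smul_apply, toLp_apply, toLp_apply, inner_smul_right, mul_div_assoc] }
    (by
      refine ⟨‖ContinuousLinearMap.adjoint K.interpolation‖, fun f => ?_⟩
      refine le_trans (le_of_eq (congrArg norm ?_))
        ((ContinuousLinearMap.adjoint K.interpolation).le_opNorm f)
      refine ext_ell2 fun C => ?_
      rw [adjoint_apply]
      exact toLp_apply K.reduced (K.memLp_projection f) C)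

theorem projection_apply (K : G.Clusters I) (f : G.ell2) (C : K.Component) :
    K.projection f C = inner ℂ (K.indicator C) f / (K.reduced.m C : ℂ) :=
  toLp_apply K.reduced (K.memLp_projection f) C

/-- A family of edge weights `a β`, `β ∈ [0, ∞)`, on the edges of `G`, starting at the weights of `G`,
constant on all edges outside the clusters, and on each cluster edge strictly increasing to infinity.
-/
structure ConnectivityFamily (K : G.Clusters I) where
  a : ℝ≥0 → V → V → ℝ
  a_nonneg : ∀ β v w, 0 ≤ a β v w
  a_pos_iff : ∀ β v w, 0 < a β v w ↔ (v, w) ∈ G.E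
  a_zero : ∀ v w, a 0 v w = G.a v w
  a_background : ∀ β β' : ℝ≥0, β < β' → ∀ v w, (v, w) ∈ G.E \ K.totalEdges → a β' v w = G.a v w
  a_cluster : ∀ β β' : ℝ≥0, β < β' → ∀ v w, (v, w) ∈ K.totalEdges → a β v w < a β' v w
  a_tendsto : ∀ v w, (v, w) ∈ K.totalEdges → Tendsto (fun β => a β v w) atTop atTop

/-- The graph `G_β` with the masses and edges of `G` and the weights `a β`. -/
abbrev ConnectivityFamily.graph {K : G.Clusters I} (F : K.ConnectivityFamily) (β : ℝ≥0) :
    WeightedGraph V where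
  m := G.m
  m_pos := G.m_pos
  E := G.E
  a := F.a β
  a_nonneg := F.a_nonneg β
  a_pos_iff := F.a_pos_iff β

end Clusters
end WeightedGraph

/-!
Write `A_β` for the Laplacian of `G_β`, and `J`, `J†` for the interpolation and projection
operators; `J` is an isometry with adjoint `J†`, whose range consists of the functions constant
across every cluster edge. Two facts drive the limit. First, the energy form dominates
`½ a_β(v, w) |h v - h w|²` for each cluster edge `(v, w)`, and a form bound `c |⟨d, h⟩|²` forces
`‖e^{-sA} d‖² ≤ 1 / (s c)`; hence `e^{-s A_β} g → 0` for `s > 0` first for the vectors `g`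
representing `h ↦ h v - h w`, then on their closed span, which is `(range J)ᗮ = ker J†`. Second, a
function in the range of `J` does not see the weights of the cluster edges, so `T = A_β J` does not
depend on `β`, and `J† T` is the Laplacian `B` of the reduced graph. In Duhamel's formula
`J e^{-tB} g - e^{-tA_β} J g = ∫₀ᵗ e^{-(t-s)A_β} (T - J B) e^{-sB} g ds`
the vector `(T - J B) e^{-sB} g` lies in `ker J†`, so the integrand tends to `0` and dominated
convergence applies.
-/

section ExpSemigroup

/-- The semigroup `s ↦ exp (-s a)` generated by `-a` in a complex Banach algebra. The parameter is
real but acts as a complex scalar, so that `WeightedGraph.heatSemigroup` is an instance by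
definition. -/
noncomputable def expSemigroup {𝔸 : Type*} [NormedRing 𝔸] [NormedAlgebra ℂ 𝔸] (a : 𝔸) (s : ℝ) :
    𝔸 :=
  NormedSpace.exp (-(s : ℂ) • a)

section BanachAlgebra

variable {𝔸 : Type*} [NormedRing 𝔸] [NormedAlgebra ℂ 𝔸]

theorem expSemigroup_eq_exp_smul_neg (a : 𝔸) (s : ℝ) :
    expSemigroup a s = NormedSpace.exp (s • -a) := by
  rw [expSemigroup, ← Complex.coe_smul, neg_smul, smul_neg]

@[simp]
theorem expSemigroup_zero (a : 𝔸) : expSemigroup a 0 = 1 := by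
  rw [expSemigroup_eq_exp_smul_neg, zero_smul, NormedSpace.exp_zero]

variable [CompleteSpace 𝔸]

theorem hasDerivAt_expSemigroup (a : 𝔸) (s : ℝ) :
    HasDerivAt (expSemigroup a) (-(expSemigroup a s * a)) s := by
  rw [funext (expSemigroup_eq_exp_smul_neg a), ← mul_neg]
  exact hasDerivAt_exp_smul_const (𝕂 := ℝ) (-a) s

theorem hasDerivAt_expSemigroup' (a : 𝔸) (s : ℝ) :
    HasDerivAt (expSemigroup a) (-(a * expSemigroup a s)) s := by
  rw [funext (expSemigroup_eq_exp_smul_neg a), ← neg_mul]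
  exact hasDerivAt_exp_smul_const' (𝕂 := ℝ) (-a) s

theorem continuous_expSemigroup (a : 𝔸) : Continuous (expSemigroup a) :=
  continuous_iff_continuousAt.2 fun s => (hasDerivAt_expSemigroup a s).continuousAt

end BanachAlgebra

section CStarAlgebra

variable {𝒜 : Type*} [CStarAlgebra 𝒜]

theorem expSemigroup_eq_cfc {a : 𝒜} (ha : IsSelfAdjoint a) (s : ℝ) :
    expSemigroup a s = cfc (fun x : ℝ => Real.exp (-s * x)) a := by
  rw [expSemigroup_eq_exp_smul_neg, smul_neg, ← neg_smul,
    ← CFC.real_exp_eq_normedSpace_exp ((IsSelfAdjoint.all (-s)).smul ha)]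
  exact (cfc_comp_const_mul (-s) Real.exp a).symm

theorem isSelfAdjoint_expSemigroup {a : 𝒜} (ha : IsSelfAdjoint a) (s : ℝ) :
    IsSelfAdjoint (expSemigroup a s) := by
  rw [expSemigroup_eq_cfc ha]
  exact cfc_predicate _ _

variable [PartialOrder 𝒜] [StarOrderedRing 𝒜]

theorem norm_expSemigroup_le_one {a : 𝒜} (ha : 0 ≤ a) {s : ℝ} (hs : 0 ≤ s) :
    ‖expSemigroup a s‖ ≤ 1 := by
  rw [expSemigroup_eq_cfc (.of_nonneg ha)]
  refine norm_cfc_le zero_le_one fun x hx => ?_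
  rw [Real.norm_eq_abs, Real.abs_exp, Real.exp_le_one_iff, neg_mul, neg_nonpos]
  exact mul_nonneg hs (spectrum_nonneg_of_nonneg ha hx)

theorem norm_mul_expSemigroup_le {a : 𝒜} (ha : 0 ≤ a) {s : ℝ} (hs : 0 < s) :
    ‖a * expSemigroup a s‖ ≤ 1 / s := by
  have ha' : IsSelfAdjoint a := .of_nonneg ha
  have hcfc : a * expSemigroup a s = cfc (fun x : ℝ => x * Real.exp (-s * x)) a := by
    rw [cfc_mul .., cfc_id' ℝ a, expSemigroup_eq_cfc ha']
  rw [hcfc]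
  refine norm_cfc_le (by positivity) fun x hx => ?_
  have hx0 : 0 ≤ x := spectrum_nonneg_of_nonneg ha hx
  have hexp : s * x ≤ Real.exp (s * x) := by linarith [Real.add_one_le_exp (s * x)]
  calc ‖x * Real.exp (-s * x)‖ = x / Real.exp (s * x) := by
        rw [Real.norm_of_nonneg (by positivity), neg_mul, Real.exp_neg, div_eq_mul_inv]
    _ ≤ 1 / s := by
        rw [div_le_div_iff₀ (Real.exp_pos _) hs]
        linarith

end CStarAlgebra

section Duhamel

variable {E F : Type*} [NormedAddCommGroup E] [NormedSpace ℂ E] [CompleteSpace E]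
  [NormedAddCommGroup F] [NormedSpace ℂ F] [CompleteSpace F]

theorem hasDerivAt_expSemigroup_sub_comp (A : E →L[ℂ] E) (B : F →L[ℂ] F) (J : F →L[ℂ] E) (t : ℝ)
    (g : F) (s : ℝ) :
    HasDerivAt (fun s => expSemigroup A (t - s) (J (expSemigroup B s g)))
      (expSemigroup A (t - s) ((A ∘L J - J ∘L B) (expSemigroup B s g))) s := by
  have hA : HasDerivAt (fun s => expSemigroup A (t - s)) (expSemigroup A (t - s) * A) s :=
    ((hasDerivAt_expSemigroup A (t - s)).scomp s ((hasDerivAt_id s).const_sub t)).congr_deriv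
      (by simp)
  have hB : HasDerivAt (fun s => J (expSemigroup B s g)) (-J (B (expSemigroup B s g))) s :=
    ((J ∘L ContinuousLinearMap.apply ℂ F g).restrictScalars ℝ).hasFDerivAt.comp_hasDerivAt s
      (hasDerivAt_expSemigroup' B s) |>.congr_deriv (by simp)
  refine (((ContinuousLinearMap.restrictScalarsL ℂ E E ℝ ℝ).hasFDerivAt.comp_hasDerivAt s
    hA).clm_apply hB).congr_deriv ?_
  simp [sub_eq_add_neg]

theorem integral_expSemigroup_sub_comp (A : E →L[ℂ] E) (B : F →L[ℂ] F) (J : F →L[ℂ] E) (t : ℝ)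
    (g : F) :
    ∫ s in (0 : ℝ)..t, expSemigroup A (t - s) ((A ∘L J - J ∘L B) (expSemigroup B s g)) =
      J (expSemigroup B t g) - expSemigroup A t (J g) := by
  have hcont : Continuous fun s =>
      expSemigroup A (t - s) ((A ∘L J - J ∘L B) (expSemigroup B s g)) :=
    ((continuous_expSemigroup A).comp (continuous_sub_left t)).clm_apply
      ((A ∘L J - J ∘L B).continuous.comp
        ((continuous_expSemigroup B).clm_apply continuous_const))
  rw [intervalIntegral.integral_eq_sub_of_hasDerivAt
    (fun s _ => hasDerivAt_expSemigroup_sub_comp A B J t g s) (hcont.intervalIntegrable _ _)]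
  simp

end Duhamel

end ExpSemigroup

section Vanishing

variable {𝕜 E F ι : Type*} [NontriviallyNormedField 𝕜] [NormedAddCommGroup E] [NormedSpace 𝕜 E]
  [NormedAddCommGroup F] [NormedSpace 𝕜 F]

/-- The vectors which a family of operators sends to `0` in the limit along a filter. For a bounded
family this subspace is closed, so strong convergence to `0` need only be checked on a set with
dense span. -/
def vanishingSubmodule (T : ι → E →L[𝕜] F) (l : Filter ι) : Submodule 𝕜 E where
  carrier := {x | Tendsto (fun i => T i x) l (𝓝 0)}
  zero_mem' := by simpa using tendsto_const_nhds
  add_mem' hx hy := by simpa using hx.add hy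
  smul_mem' c x hx := by simpa using hx.const_smul c

theorem isClosed_vanishingSubmodule {T : ι → E →L[𝕜] F} {C : ℝ≥0} (hT : ∀ i, ‖T i‖ ≤ C)
    (l : Filter ι) : IsClosed (vanishingSubmodule T l : Set E) :=
  (LipschitzWith.uniformEquicontinuous (fun i => T i) C fun i =>
    (T i).lipschitz.weaken (hT i)).equicontinuous.isClosed_setOfPred_tendsto continuous_const

end Vanishing

section StrongLimit

open scoped InnerProductSpace InnerProduct

variable {ι H H' : Type*} [NormedAddCommGroup H] [InnerProductSpace ℂ H]
  [NormedAddCommGroup H'] [InnerProductSpace ℂ H']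

/-- The quadratic forms of the operators `A i` blow up on the vector `d` along the filter `l`: they
dominate `c i |⟨d, h⟩|²` with coupling constants `c i` tending to infinity. -/
def FormBlowsUpOn (A : ι → H →L[ℂ] H) (l : Filter ι) (d : H) : Prop :=
  ∃ c : ι → ℝ, Tendsto c l atTop ∧ ∀ i h, c i * ‖⟪d, h⟫_ℂ‖ ^ 2 ≤ (A i).reApplyInnerSelf h

variable [CompleteSpace H] [CompleteSpace H']

theorem mul_norm_expSemigroup_apply_sq_le {A : H →L[ℂ] H} (hA : A.IsPositive) {c : ℝ} {d : H}
    (hd : ∀ h, c * ‖⟪d, h⟫_ℂ‖ ^ 2 ≤ A.reApplyInnerSelf h) {s : ℝ} (hs : 0 < s) :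
    c * ‖expSemigroup A s d‖ ^ 2 ≤ 1 / s := by
  have hA0 : 0 ≤ A := A.nonneg_iff_isPositive.2 hA
  set P := expSemigroup A s
  rcases eq_or_ne (P d) 0 with h0 | h0
  · rw [h0, norm_zero]
    simpa using hs.le
  have hinner : ‖⟪d, P (P d)⟫_ℂ‖ = ‖P d‖ ^ 2 := by
    have hP : P† = P := isSelfAdjoint_expSemigroup hA.isSelfAdjoint s
    rw [← ContinuousLinearMap.adjoint_inner_left, hP, inner_self_eq_norm_sq_to_K]
    simp
  have hform : A.reApplyInnerSelf (P (P d)) ≤ 1 / s * ‖P d‖ ^ 2 :=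
    calc A.reApplyInnerSelf (P (P d)) ≤ ‖A (P (P d))‖ * ‖P (P d)‖ := re_inner_le_norm _ _
      _ ≤ (1 / s * ‖P d‖) * (1 * ‖P d‖) := by
        gcongr
        · exact (A * P).le_of_opNorm_le (norm_mul_expSemigroup_le hA0 hs) _
        · exact P.le_of_opNorm_le (norm_expSemigroup_le_one hA0 hs.le) _
      _ = 1 / s * ‖P d‖ ^ 2 := by ring
  refine le_of_mul_le_mul_right ?_ (show 0 < ‖P d‖ ^ 2 by positivity)
  calc c * ‖P d‖ ^ 2 * ‖P d‖ ^ 2 = c * ‖⟪d, P (P d)⟫_ℂ‖ ^ 2 := by rw [hinner]; ring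
    _ ≤ 1 / s * ‖P d‖ ^ 2 := (hd _).trans hform

variable {A : ι → H →L[ℂ] H} {l : Filter ι}

theorem tendsto_expSemigroup_apply_zero_of_formBlowsUpOn (hA : ∀ i, (A i).IsPositive) {d : H}
    (hd : FormBlowsUpOn A l d) {s : ℝ} (hs : 0 < s) :
    Tendsto (fun i => expSemigroup (A i) s d) l (𝓝 0) := by
  obtain ⟨c, hc, hform⟩ := hd
  have hsq : Tendsto (fun i => ‖expSemigroup (A i) s d‖ ^ 2) l (𝓝 0) := by
    refine squeeze_zero' (Eventually.of_forall fun i => by positivity) ?_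
      ((tendsto_const_nhds (x := 1 / s)).div_atTop hc)
    filter_upwards [hc.eventually_gt_atTop 0] with i hi
    rw [le_div_iff₀' hi]
    exact mul_norm_expSemigroup_apply_sq_le (hA i) (hform i) hs
  rw [tendsto_zero_iff_norm_tendsto_zero]
  simpa [Real.sqrt_sq] using hsq.sqrt

theorem tendsto_expSemigroup_apply_zero_of_mem_closure_span (hA : ∀ i, (A i).IsPositive) {D : Set H}
    (hD : ∀ d ∈ D, FormBlowsUpOn A l d) {g : H} (hg : g ∈ (Submodule.span ℂ D).topologicalClosure)
    {s : ℝ} (hs : 0 < s) : Tendsto (fun i => expSemigroup (A i) s g) l (𝓝 0) := by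
  have hclosed := isClosed_vanishingSubmodule (T := fun i => expSemigroup (A i) s) (C := 1)
    (fun i => norm_expSemigroup_le_one ((A i).nonneg_iff_isPositive.2 (hA i)) hs.le) l
  have hspan : Submodule.span ℂ D ≤ vanishingSubmodule (fun i => expSemigroup (A i) s) l :=
    Submodule.span_le.2 fun d hd =>
      tendsto_expSemigroup_apply_zero_of_formBlowsUpOn hA (hD d hd) hs
  exact Submodule.topologicalClosure_minimal _ hspan hclosed hg

theorem mem_closure_span_of_adjoint_eq_zero {J : H' →L[ℂ] H} {D : Set H}
    (hD : (Submodule.span ℂ D)ᗮ ≤ J.range) {g : H} (hg : (J†) g = 0) :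
    g ∈ (Submodule.span ℂ D).topologicalClosure := by
  rw [← Submodule.orthogonal_orthogonal_eq_closure]
  refine Submodule.orthogonal_le hD ?_
  rwa [ContinuousLinearMap.orthogonal_range]

variable [l.IsCountablyGenerated] {J T : H' →L[ℂ] H}

theorem tendsto_expSemigroup_apply_range (hA : ∀ i, (A i).IsPositive)
    (hvanish : ∀ g, (J†) g = 0 → ∀ s > 0, Tendsto (fun i => expSemigroup (A i) s g) l (𝓝 0))
    (hJ : J† ∘L J = .id ℂ H') (hT : ∀ i, A i ∘L J = T) {t : ℝ} (ht : 0 ≤ t) (g : H') :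
    Tendsto (fun i => expSemigroup (A i) t (J g)) l (𝓝 (J (expSemigroup (J† ∘L T) t g))) := by
  set B := J† ∘L T
  have hker : ∀ h, (J†) ((T - J ∘L B) h) = 0 := fun h => by
    have hJ' : ∀ x, (J†) (J x) = x := DFunLike.congr_fun hJ
    simp [B, hJ']
  have hcont : Continuous fun s => (T - J ∘L B) (expSemigroup B s g) :=
    (T - J ∘L B).continuous.comp ((continuous_expSemigroup B).clm_apply continuous_const)
  have hintegral : Tendsto (fun i => ∫ s in (0 : ℝ)..t,
      expSemigroup (A i) (t - s) ((T - J ∘L B) (expSemigroup B s g))) l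
      (𝓝 (∫ _ in (0 : ℝ)..t, (0 : H))) := by
    refine intervalIntegral.tendsto_integral_filter_of_dominated_convergence
      (fun s => ‖(T - J ∘L B) (expSemigroup B s g)‖) (Eventually.of_forall fun i => ?_)
      (Eventually.of_forall fun i => Eventually.of_forall fun s hs => ?_)
      (hcont.norm.intervalIntegrable _ _) ?_
    · exact (((continuous_expSemigroup (A i)).comp (continuous_sub_left t)).clm_apply
        hcont).aestronglyMeasurable
    · rw [Set.uIoc_of_le ht] at hs
      simpa only [one_mul] using ContinuousLinearMap.le_of_opNorm_le _ (norm_expSemigroup_le_one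
        ((A i).nonneg_iff_isPositive.2 (hA i)) (sub_nonneg.2 hs.2)) _
    · filter_upwards [Measure.ae_ne volume t] with s hst hs
      rw [Set.uIoc_of_le ht] at hs
      exact hvanish _ (hker _) _ (sub_pos.2 (lt_of_le_of_ne hs.2 hst))
  have hduhamel := fun i => integral_expSemigroup_sub_comp (A i) B J t g
  simp only [hT] at hduhamel
  simp only [hduhamel, intervalIntegral.integral_zero] at hintegral
  simpa using (tendsto_const_nhds (x := J (expSemigroup B t g))).sub hintegral

theorem tendsto_expSemigroup_apply (hA : ∀ i, (A i).IsPositive) {D : Set H}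
    (hD : ∀ d ∈ D, FormBlowsUpOn A l d) (hDJ : (Submodule.span ℂ D)ᗮ ≤ J.range)
    (hJ : J† ∘L J = .id ℂ H') (hT : ∀ i, A i ∘L J = T) {t : ℝ} (ht : 0 < t) (f : H) :
    Tendsto (fun i => expSemigroup (A i) t f) l (𝓝 (J (expSemigroup (J† ∘L T) t ((J†) f)))) := by
  have hvanish : ∀ g, (J†) g = 0 → ∀ s > 0, Tendsto (fun i => expSemigroup (A i) s g) l (𝓝 0) :=
    fun g hg s hs => tendsto_expSemigroup_apply_zero_of_mem_closure_span hA hD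
      (mem_closure_span_of_adjoint_eq_zero hDJ hg) hs
  have hker : (J†) (f - J ((J†) f)) = 0 := by
    rw [map_sub, sub_eq_zero]
    exact (DFunLike.congr_fun hJ ((J†) f)).symm
  simpa using (hvanish _ hker t ht).add
    (tendsto_expSemigroup_apply_range hA hvanish hJ hT ht.le ((J†) f))

end StrongLimit

section WeightedSums

open scoped ComplexConjugate

theorem summable_ofReal_mul_conj_mul {α : Type*} {w : α → ℝ} (hw : ∀ i, 0 ≤ w i) {f g : α → ℂ}
    (hf : Summable fun i => w i * ‖f i‖ ^ 2) (hg : Summable fun i => w i * ‖g i‖ ^ 2) :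
    Summable fun i => (w i : ℂ) * (conj (f i) * g i) := by
  refine Summable.of_norm_bounded (hf.add hg) fun i => ?_
  rw [norm_mul, norm_mul, Complex.norm_conj, Complex.norm_of_nonneg (hw i), ← mul_add]
  gcongr
  · exact hw i
  · nlinarith [sq_nonneg (‖f i‖ - ‖g i‖), sq_nonneg ‖f i‖, sq_nonneg ‖g i‖]

end WeightedSums

namespace WeightedGraph

open scoped ComplexConjugate InnerProductSpace

variable {V : Type*}

theorem hasSum_aggregate_mul {W : Type*} (q : V → W) {a : V → V → ℝ} {φ : W × W → ℂ} {s : ℂ}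
    (h : HasSum (fun p : V × V => (a p.1 p.2 : ℂ) * φ (Prod.map q q p)) s) :
    HasSum (fun P : W × W => (aggregate q a P.1 P.2 : ℂ) * φ P) s := by
  refine (h.tsum_fiberwise (Prod.map q q)).congr_fun fun P => ?_
  let e : {v // q v = P.1} × {w // q w = P.2} ≃ Prod.map q q ⁻¹' {P} :=
    { toFun x := ⟨(x.1, x.2), Prod.ext x.1.2 x.2.2⟩
      invFun y := (⟨y.1.1, congrArg Prod.fst y.2⟩, ⟨y.1.2, congrArg Prod.snd y.2⟩) }
  rw [aggregate, Complex.ofReal_tsum, ← tsum_mul_right, ← e.tsum_eq]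
  refine tsum_congr fun x => ?_
  rw [show Prod.map q q (e x) = P from (e x).2]
  rfl

theorem BoundedDegrees.transpose {G : WeightedGraph V} (hG : G.BoundedDegrees) :
    G.transpose.BoundedDegrees := by
  obtain ⟨C, hC, h⟩ := hG
  exact ⟨C, hC, fun v => ⟨(h v).2, (h v).1⟩⟩

theorem IsUndirected.weight_comm {G : WeightedGraph V} (h : G.IsUndirected) (v w : V) :
    G.a v w = G.a w v :=
  congrFun₂ (congrArg WeightedGraph.a h) v w

section Laplacian

variable (G : WeightedGraph V)

theorem hasSum_inner (f g : G.ell2) :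
    HasSum (fun v => (G.m v : ℂ) * (conj (f v) * g v)) ⟪f, g⟫_ℂ := by
  let _ : MeasurableSpace V := ⊤
  have hint : Integrable (fun v => ⟪f v, g v⟫_ℂ) (massMeasure G.m) := L2.integrable_inner f g
  rw [L2.inner_def]
  refine (hasSum_integral_measure hint).congr_fun fun v => ?_
  rw [integral_smul_measure, integral_dirac, ENNReal.toReal_ofReal (G.m_pos v).le]
  simp [mul_comm]

theorem summable_mass_mul_norm_sq (f : G.ell2) : Summable fun v => G.m v * ‖f v‖ ^ 2 :=
  (G.hasSum_inner f f).summable.norm.congr fun v => by simp [abs_of_pos (G.m_pos v), sq]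

variable {G} in
theorem BoundedDegrees.summable_weight_mul_norm_fst_sq (hG : G.BoundedDegrees) (f : G.ell2) :
    Summable fun p : V × V => G.a p.1 p.2 * ‖f p.1‖ ^ 2 := by
  obtain ⟨C, -, h⟩ := hG
  have hnonneg : ∀ x y, 0 ≤ G.a x y * ‖f x‖ ^ 2 := fun x y =>
    mul_nonneg (G.a_nonneg x y) (by positivity)
  rw [summable_prod_of_nonneg fun p => hnonneg p.1 p.2]
  refine ⟨fun x => (h x).1.1.mul_right (‖f x‖ ^ 2), ?_⟩
  refine Summable.of_nonneg_of_le (fun x => tsum_nonneg (hnonneg x)) (fun x => ?_)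
    ((G.summable_mass_mul_norm_sq f).mul_left C)
  simp only [tsum_mul_right, ← mul_assoc]
  gcongr
  exact (h x).1.2

variable {G} in
theorem BoundedDegrees.summable_weight_mul_norm_snd_sq (hG : G.BoundedDegrees) (f : G.ell2) :
    Summable fun p : V × V => G.a p.1 p.2 * ‖f p.2‖ ^ 2 :=
  (Equiv.prodComm V V).summable_iff.2 (hG.transpose.summable_weight_mul_norm_fst_sq f)

theorem hasSum_laplacian (hG : G.BoundedDegrees) (f : G.ell2) (x : V) :
    HasSum (fun y => (G.a x y : ℂ) * (f x - f y)) ((G.m x : ℂ) * G.laplacian hG f x) := by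
  have hdeg : HasSum (fun y => (G.a x y : ℂ)) (G.inDegree x : ℂ) := by
    obtain ⟨C, -, h⟩ := hG
    exact Complex.hasSum_ofReal.2 (h x).1.1.hasSum
  have hm : (G.m x : ℂ) ≠ 0 := by exact_mod_cast (G.m_pos x).ne'
  rw [laplacian_apply, ← mul_assoc, mul_one_div_cancel hm, one_mul]
  exact ((hdeg.mul_right (f x)).sub (hG.summable f x).hasSum).congr_fun fun y => mul_sub _ _ _

theorem hasSum_inner_laplacian (hG : G.BoundedDegrees) (f g : G.ell2) :
    HasSum (fun p : V × V => (G.a p.1 p.2 : ℂ) * (conj (f p.1) * (g p.1 - g p.2)))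
      ⟪f, G.laplacian hG g⟫_ℂ := by
  have hnonneg : ∀ p : V × V, 0 ≤ G.a p.1 p.2 := fun p => G.a_nonneg p.1 p.2
  have hf := hG.summable_weight_mul_norm_fst_sq f
  have hsum : Summable fun p : V × V => (G.a p.1 p.2 : ℂ) * (conj (f p.1) * (g p.1 - g p.2)) :=
    ((summable_ofReal_mul_conj_mul hnonneg hf (hG.summable_weight_mul_norm_fst_sq g)).sub
      (summable_ofReal_mul_conj_mul hnonneg hf (hG.summable_weight_mul_norm_snd_sq g))).congr
      fun p => by ring
  have hrow : ∀ x, HasSum (fun y => (G.a x y : ℂ) * (conj (f x) * (g x - g y)))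
      ((G.m x : ℂ) * (conj (f x) * G.laplacian hG g x)) := fun x => by
    rw [mul_left_comm]
    exact ((G.hasSum_laplacian hG g x).mul_left (conj (f x))).congr_fun fun y =>
      mul_left_comm _ _ _
  exact (hsum.hasSum.prod_fiberwise hrow).unique (G.hasSum_inner f _) ▸ hsum.hasSum

variable {G}

theorem IsUndirected.hasSum_two_mul_inner_laplacian (hu : G.IsUndirected) (hG : G.BoundedDegrees)
    (f g : G.ell2) :
    HasSum (fun p : V × V => (G.a p.1 p.2 : ℂ) * (conj (f p.1 - f p.2) * (g p.1 - g p.2)))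
      (2 * ⟪f, G.laplacian hG g⟫_ℂ) := by
  have h := G.hasSum_inner_laplacian hG f g
  rw [two_mul]
  refine (h.add ((Equiv.prodComm V V).hasSum_iff.2 h)).congr_fun fun p => ?_
  simp only [Function.comp_apply, Equiv.prodComm_apply, Prod.fst_swap, Prod.snd_swap, map_sub]
  rw [hu.weight_comm p.2 p.1]
  ring

theorem IsUndirected.hasSum_energy (hu : G.IsUndirected) (hG : G.BoundedDegrees) (f : G.ell2) :
    HasSum (fun p : V × V => G.a p.1 p.2 * ‖f p.1 - f p.2‖ ^ 2)
      (2 * (G.laplacian hG).reApplyInnerSelf f) := by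
  have h := Complex.hasSum_re (hu.hasSum_two_mul_inner_laplacian hG f f)
  rw [ContinuousLinearMap.reApplyInnerSelf_apply, inner_re_symm]
  simpa [← Complex.normSq_eq_conj_mul_self, ← map_sub, Complex.normSq_eq_norm_sq,
    ← Complex.ofReal_pow] using h

theorem IsUndirected.isPositive_laplacian (hu : G.IsUndirected) (hG : G.BoundedDegrees) :
    (G.laplacian hG).IsPositive := by
  refine ContinuousLinearMap.isPositive_def.2 ⟨fun f g => ?_, fun f => ?_⟩
  · have hconj := Complex.hasSum_conj'.2 (hu.hasSum_two_mul_inner_laplacian hG g f)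
    have h := hconj.unique <| (hu.hasSum_two_mul_inner_laplacian hG f g).congr_fun fun p => by
      simp only [map_mul, map_sub, Complex.conj_ofReal, Complex.conj_conj]
      ring
    rw [map_mul, inner_conj_symm, Complex.conj_ofNat] at h
    exact mul_left_cancel₀ two_ne_zero h
  · have h := (hu.hasSum_energy hG f).nonneg fun p => mul_nonneg (G.a_nonneg _ _) (by positivity)
    exact nonneg_of_mul_nonneg_right h two_pos

theorem IsUndirected.weight_mul_norm_sub_sq_le (hu : G.IsUndirected) (hG : G.BoundedDegrees)
    (f : G.ell2) (x y : V) :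
    G.a x y / 2 * ‖f x - f y‖ ^ 2 ≤ (G.laplacian hG).reApplyInnerSelf f := by
  have h := le_hasSum (hu.hasSum_energy hG f) (x, y) fun p _ =>
    mul_nonneg (G.a_nonneg p.1 p.2) (by positivity)
  dsimp only at h
  linarith

end Laplacian

section EvalVector

variable (G : WeightedGraph V)

theorem memLp_massMeasure_single [DecidableEq V] (m : V → ℝ) (v : V) (c : ℂ) :
    @MemLp V ℂ ⊤ _ _ (Pi.single v c) 2 (massMeasure m) := by
  rw [memLp_massMeasure_iff, tsum_eq_single v fun w hw => by simp [hw]]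
  exact ENNReal.mul_ne_top ENNReal.ofReal_ne_top (ENNReal.pow_ne_top enorm_ne_top)

open Classical in
/-- The vector of `ℓ²(G)` representing evaluation at the vertex `v`: the point mass at `v`
normalised by `1 / m v`. -/
noncomputable def evalVector (v : V) : G.ell2 :=
  (memLp_massMeasure_single G.m v (1 / (G.m v : ℂ))).toLp _

theorem inner_evalVector (v : V) (f : G.ell2) : ⟪G.evalVector v, f⟫_ℂ = f v := by
  classical
  have hm : (G.m v : ℂ) ≠ 0 := by exact_mod_cast (G.m_pos v).ne'
  refine (G.hasSum_inner _ f).unique ?_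
  simp only [evalVector, toLp_apply]
  convert hasSum_single v fun w hw => ?_ using 1
  · simp [hm]
  · simp [hw]

end EvalVector

/-- The graph with the vertices, masses and edges of `G` and with edge weights `a`. -/
abbrev reweight (G : WeightedGraph V) (a : V → V → ℝ) (ha : ∀ v w, 0 ≤ a v w)
    (hE : ∀ v w, 0 < a v w ↔ (v, w) ∈ G.E) : WeightedGraph V where
  m := G.m
  m_pos := G.m_pos
  E := G.E
  a := a
  a_nonneg := ha
  a_pos_iff := hE

namespace Clusters

variable {G : WeightedGraph V} {I : Type*} (K : G.Clusters I)

theorem adjoint_interpolation : ContinuousLinearMap.adjoint K.interpolation = K.projection := by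
  ext1 f
  refine ext_ell2 fun C => ?_
  rw [adjoint_apply, projection_apply]

theorem projection_comp_interpolation :
    K.projection ∘L K.interpolation = ContinuousLinearMap.id ℂ K.reduced.ell2 := by
  rw [← adjoint_interpolation]
  refine (ContinuousLinearMap.norm_map_iff_adjoint_comp_self K.interpolation).1 fun g => ?_
  let _ : MeasurableSpace V := ⊤
  let _ : MeasurableSpace K.Component := ⊤
  exact Lp.norm_compMeasurePreserving g K.measurePreserving

theorem projection_comp_laplacian_comp_interpolation (hG : G.BoundedDegrees) :
    K.projection ∘L G.laplacian hG ∘L K.interpolation =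
      K.reduced.laplacian (K.reduced_boundedDegrees hG) := by
  ext1 g
  refine ext_inner_left ℂ fun h => ?_
  rw [ContinuousLinearMap.comp_apply, ContinuousLinearMap.comp_apply, ← adjoint_interpolation,
    ContinuousLinearMap.adjoint_inner_right]
  have hform := G.hasSum_inner_laplacian hG (K.interpolation h) (K.interpolation g)
  simp only [interpolation_apply] at hform
  exact (hasSum_aggregate_mul K.component (φ := fun P => conj (h P.1) * (g P.1 - g P.2))
    hform).unique (K.reduced.hasSum_inner_laplacian _ h g)

theorem component_eq_of_mem {v w : V} (h : (v, w) ∈ K.totalEdges) :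
    K.component v = K.component w :=
  Quotient.sound (Relation.ReflTransGen.single h)

theorem mem_range_interpolation {f : G.ell2} (hf : ∀ v w, (v, w) ∈ K.totalEdges → f v = f w) :
    f ∈ K.interpolation.range := by
  have hsees : ∀ v w, Sees K.totalEdges v w → f v = f w := fun v w h => by
    induction h with
    | refl => rfl
    | tail _ hbc ih => exact ih.trans (hf _ _ hbc)
  let g : K.Component → ℂ := Quotient.lift f hsees
  have hg : @MemLp K.Component ℂ ⊤ _ _ g 2 (massMeasure K.reduced.m) := by
    let _ : MeasurableSpace V := ⊤
    let _ : MeasurableSpace K.Component := ⊤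
    rw [← K.measurePreserving.map_eq]
    exact (memLp_map_measure_iff measurable_from_top.aestronglyMeasurable
      measurable_from_top.aemeasurable).2 (Lp.memLp f)
  refine ⟨hg.toLp g, ext_ell2 fun v => ?_⟩
  exact (K.interpolation_apply _ v).trans (K.reduced.toLp_apply hg _)

/-- The vectors of `ℓ²(G)` representing the differences `f v - f w` over the cluster edges
`(v, w)`. -/
def edgeDifferences : Set G.ell2 :=
  (fun p : V × V => G.evalVector p.1 - G.evalVector p.2) '' K.totalEdges

theorem orthogonal_span_edgeDifferences_le :
    (Submodule.span ℂ K.edgeDifferences)ᗮ ≤ K.interpolation.range := fun f hf =>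
  K.mem_range_interpolation fun v w hvw => by
    have h := hf _ (Submodule.subset_span ⟨(v, w), hvw, rfl⟩)
    rwa [inner_sub_left, inner_evalVector, inner_evalVector, sub_eq_zero] at h

theorem laplacian_reweight_comp_interpolation {a : V → V → ℝ} {ha : ∀ v w, 0 ≤ a v w}
    {hE : ∀ v w, 0 < a v w ↔ (v, w) ∈ G.E} (haG : ∀ v w, (v, w) ∉ K.totalEdges → a v w = G.a v w)
    (hG : G.BoundedDegrees) (hGa : (G.reweight a ha hE).BoundedDegrees) :
    (G.reweight a ha hE).laplacian hGa ∘L K.interpolation = G.laplacian hG ∘L K.interpolation := by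
  ext1 g
  refine ext_ell2 (G := G) fun x => ?_
  have hm : (G.m x : ℂ) ≠ 0 := by exact_mod_cast (G.m_pos x).ne'
  refine mul_left_cancel₀ hm <| ((G.reweight a ha hE).hasSum_laplacian hGa _ x).unique <|
    (G.hasSum_laplacian hG _ x).congr_fun fun y => ?_
  by_cases h : (x, y) ∈ K.totalEdges
  · simp [interpolation_apply, K.component_eq_of_mem h]
  · exact congrArg (fun r : ℝ => (r : ℂ) * _) (haG x y h)

theorem formBlowsUpOn_laplacian_reweight {ι : Type*} {l : Filter ι} {a : ι → V → V → ℝ}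
    {ha : ∀ i v w, 0 ≤ a i v w} {hE : ∀ i v w, 0 < a i v w ↔ (v, w) ∈ G.E}
    (hu : ∀ i, (G.reweight (a i) (ha i) (hE i)).IsUndirected)
    (hb : ∀ i, (G.reweight (a i) (ha i) (hE i)).BoundedDegrees)
    (hlim : ∀ v w, (v, w) ∈ K.totalEdges → Tendsto (fun i => a i v w) l atTop) {d : G.ell2}
    (hd : d ∈ K.edgeDifferences) :
    FormBlowsUpOn (H := G.ell2)
      (fun i => (G.reweight (a i) (ha i) (hE i)).laplacian (hb i)) l d := by
  obtain ⟨⟨v, w⟩, hvw, rfl⟩ := hd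
  refine ⟨fun i => a i v w / 2, (hlim v w hvw).atTop_div_const two_pos, fun i h => ?_⟩
  rw [inner_sub_left, inner_evalVector, inner_evalVector]
  exact (hu i).weight_mul_norm_sub_sq_le (hb i) h v w

theorem ConnectivityFamily.weight_eq {K : G.Clusters I} (F : K.ConnectivityFamily) (β : ℝ≥0)
    {v w : V} (h : (v, w) ∉ K.totalEdges) : F.a β v w = G.a v w := by
  by_cases hE : (v, w) ∈ G.E
  · rcases eq_zero_or_pos β with rfl | hβ
    · exact F.a_zero v w
    · exact F.a_background 0 β hβ v w ⟨hE, h⟩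
  · have hF : ¬ 0 < F.a β v w := mt (F.a_pos_iff β v w).1 hE
    have hG : ¬ 0 < G.a v w := mt (G.a_pos_iff v w).1 hE
    rw [le_antisymm (not_lt.1 hF) (F.a_nonneg β v w), le_antisymm (not_lt.1 hG) (G.a_nonneg v w)]

end Clusters

end WeightedGraph

theorem mainTheorem9_general {V : Type*} {G : WeightedGraph V} (hG : G.BoundedDegrees)
    {I : Type*} (K : G.Clusters I) {ι : Type*} {l : Filter ι} [l.IsCountablyGenerated]
    {a : ι → V → V → ℝ} {ha : ∀ i v w, 0 ≤ a i v w}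
    {hE : ∀ i v w, 0 < a i v w ↔ (v, w) ∈ G.E}
    (hu : ∀ i, (G.reweight (a i) (ha i) (hE i)).IsUndirected)
    (hb : ∀ i, (G.reweight (a i) (ha i) (hE i)).BoundedDegrees)
    (haG : ∀ i v w, (v, w) ∉ K.totalEdges → a i v w = G.a v w)
    (hlim : ∀ v w, (v, w) ∈ K.totalEdges → Tendsto (fun i => a i v w) l atTop)
    {t : ℝ} (ht : 0 < t) (f : G.ell2) :
    Tendsto (fun i => (G.reweight (a i) (ha i) (hE i)).heatSemigroup (hb i) t f) l
      (𝓝 (K.interpolation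
        (K.reduced.heatSemigroup (K.reduced_boundedDegrees hG) t (K.projection f)))) := by
  have h := tendsto_expSemigroup_apply (H := G.ell2) (J := K.interpolation)
    (T := G.laplacian hG ∘L K.interpolation) (fun i => (hu i).isPositive_laplacian (hb i))
    (fun d => K.formBlowsUpOn_laplacian_reweight hu hb hlim)
    K.orthogonal_span_edgeDifferences_le
    (by rw [K.adjoint_interpolation, K.projection_comp_interpolation])
    (fun i => K.laplacian_reweight_comp_interpolation (haG i) hG (hb i)) ht f
  rwa [K.adjoint_interpolation, K.projection_comp_laplacian_comp_interpolation hG] at h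

theorem mainTheorem9 {V : Type*} [Countable V] (G : WeightedGraph V)
    (hG_loc : G.LocallyFinite) (hG_und : G.IsUndirected) (hG_bdd : G.BoundedDegrees)
    {I : Type*} [Countable I] (K : G.Clusters I) (F : K.ConnectivityFamily)
    (hF_und : ∀ β, (F.graph β).IsUndirected) (hF_bdd : ∀ β, (F.graph β).BoundedDegrees)
    (t : ℝ) (ht : 0 < t) (f : G.ell2) :
    Tendsto (fun β : ℝ≥0 => (F.graph β).heatSemigroup (hF_bdd β) t f) atTop
      (𝓝 (K.interpolation
        (K.reduced.heatSemigroup (K.reduced_boundedDegrees hG_bdd) t (K.projection f)))) :=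
  mainTheorem9_general hG_bdd K hF_und hF_bdd (fun β _ _ => F.weight_eq β) F.a_tendsto ht f
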